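/- Let $H\in\mathbb{R}^{n\times n}$ be symmetric positive definite with largest and smallest eigenvalues $\lambda_{\max}$, $\lambda_{\min}$ and condition number $\kappa=\lambda_{\max}/\lambda_{\min}$, let $b\in\mathbb{R}^n$, and let $f(x)=\frac12x^{T}Hx+b^{T}x$ with gradient $G=\nabla f$. Fix $x_0\in\mathbb{R}^n$ and $\alpha_0>0$, and consider the gradient iterations $$x_{k+1}=x_k-\alpha_kG(x_k),\qquad k\ge 0,$$ started from the same $(x_0,\alpha_0)$, where the later step-sizes are given either by the short KGD step $$\alpha_{k+1}=\mathcal{K}_1^{\rm s}(x_{k+1};x_k,\alpha_k):=\frac{2\left(\alpha_k\|G(x_k)\|_2^2+f(x_{k+1})-f(x_k)\right)}{\|G(x_{k+1})-G(x_k)\|_2^2}$$ or by the short Barzilai–Borwein step $$\alpha_{k+1}=\alpha_{k+1}^{\rm BB2}:=\frac{s_k^{T}y_k}{y_k^{T}y_k},\qquad s_k=x_{k+1}-x_k,\quad y_k=G(x_{k+1})-G(x_k).$$ These formulas are used as long as $G(x_k)\neq0$; if $G(x_k)=0$ the method has terminated and all later iterates equal $x_k$. Then, in exact arithmetic, the two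 iterations generate the same sequence $\{x_k\}$. Moreover $x^*=-H^{-1}b$ is the unique minimizer of $f$, the sequence $\{x_k\}$ converges to $x^*$, and the convergence is at least R-linear with rate $1-\frac1\kappa$: there is a constant $C$ (which may depend on $H,b,x_0,\alpha_0$) such that $$\|x_k-x^*\|_2\le C\left(1-\frac1\kappa\right)^k\qquad\text{for all }k\ge 2.$$ (The restriction $k\ge2$ matters only when $\kappa=1$, in which case the bound says $x_k=x^*$ for all $k\ge2$.) -/

import Mathlib

open Filter Topology Matrix

noncomputable section

/-- The quadratic function `f(x) = ½ xᵀ H x + bᵀ x` on Euclidean space. -/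
def quadraticObjective {n : ℕ} (H : Matrix (Fin n) (Fin n) ℝ) (b : EuclideanSpace ℝ (Fin n))
    (x : EuclideanSpace ℝ (Fin n)) : ℝ :=
  (1 / 2) * (x.ofLp ⬝ᵥ (H *ᵥ x.ofLp)) + b.ofLp ⬝ᵥ x.ofLp

/-- The point `x* = -H⁻¹ b`. -/
def quadraticMinimizer {n : ℕ} (H : Matrix (Fin n) (Fin n) ℝ) (b : EuclideanSpace ℝ (Fin n)) :
    EuclideanSpace ℝ (Fin n) :=
  WithLp.toLp 2 (-(H⁻¹ *ᵥ b.ofLp))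

/-- The condition number `κ(H) = λ_max(H) / λ_min(H)` of a symmetric (positive definite) matrix. -/
def conditionNumber {n : ℕ} {H : Matrix (Fin n) (Fin n) ℝ} (hH : H.IsHermitian) : ℝ :=
  (⨆ i, hH.eigenvalues i) / (⨅ i, hH.eigenvalues i)

/-- The short KGD step-size `K₁ˢ(x_new; x, α)` for a differentiable objective `f`
(to be used with `x_new = x - α ∇f(x)`). -/
def shortKGDStep {n : ℕ} (f : EuclideanSpace ℝ (Fin n) → ℝ)
    (xnew x : EuclideanSpace ℝ (Fin n)) (α : ℝ) : ℝ :=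
  2 * (α * ‖gradient f x‖ ^ 2 + (f xnew - f x)) / ‖gradient f xnew - gradient f x‖ ^ 2

/-- The short Barzilai-Borwein step-size `sᵀy / yᵀy` for `x_new`, where `s = x_new - x` and
`y = ∇f(x_new) - ∇f(x)`. -/
def shortBBStep {n : ℕ} (f : EuclideanSpace ℝ (Fin n) → ℝ)
    (xnew x : EuclideanSpace ℝ (Fin n)) : ℝ :=
  inner ℝ (xnew - x) (gradient f xnew - gradient f x) /
    inner ℝ (gradient f xnew - gradient f x) (gradient f xnew - gradient f x)

/-- `(x k, α k)` is generated from `(x₀, α₀)` by the gradient iteration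
`x (k+1) = x k - α k ∇f(x k)`, `α (k+1) = step (x (k+1)) (x k) (α k)`.
The step-size formulas are `0 / 0` once `∇f(x k) = 0`, and the method has then terminated; so the
formula is required only while `∇f(x k) ≠ 0`, and afterwards `α` is unconstrained (whatever its
values, `x` stays at the stationary point reached). -/
structure IsGradientIteration {n : ℕ} (f : EuclideanSpace ℝ (Fin n) → ℝ)
    (step : EuclideanSpace ℝ (Fin n) → EuclideanSpace ℝ (Fin n) → ℝ → ℝ)
    (x₀ : EuclideanSpace ℝ (Fin n)) (α₀ : ℝ)
    (x : ℕ → EuclideanSpace ℝ (Fin n)) (α : ℕ → ℝ) : Prop where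
  x_zero : x 0 = x₀
  α_zero : α 0 = α₀
  x_succ : ∀ k, x (k + 1) = x k - α k • gradient f (x k)
  α_succ : ∀ k, gradient f (x k) ≠ 0 → α (k + 1) = step (x (k + 1)) (x k) (α k)

end

/-! The second-order expansion of a quadratic is exact, so along a gradient step the KGD numerator
equals `sᵀy` and both rules give the same step. In an eigenbasis of `H` the error components satisfy
`u (k+1) i = (1 - α k * lam i) * u k i`, and `α (k+1)` is the inverse of a mean of the eigenvalues
with weights `lam j ^ 3 * u k j ^ 2`. Hence `1/L ≤ α (k+1) ≤ 1/m`, and `1 - α (k+1) * lam i ≤ ρ := 1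
- m/L` always holds; only large eigenvalues can break the lower bound `-ρ`.
`exists_abs_le_mul_pow_of_weighted_step` handles these by induction on the eigenvalue. Suppose the
components with smaller eigenvalue are `O(ρ^k)`. Either `u k i` is also `O(ρ^k)`, and two steps of
bounded growth keep it so, or it dominates them; then `weighted_step_mul_le` gives `α (k+1) * lam i
≤ 1 + ρ` and the next step contracts by `ρ`. -/

/-! ### Diagonal iterations with delayed weighted step-sizes. -/

/-- A step-size that is the inverse of a weighted mean of the spectrum is at least `1 / L`. -/
lemma one_le_mul_weighted_step {ι : Type*} [Fintype ι] {lam w u : ι → ℝ} {L : ℝ}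
    (hw : ∀ i, 0 < w i) (hlam : ∀ i, 0 < lam i) (hL : ∀ i, lam i ≤ L) (hu : u ≠ 0) :
    1 ≤ (∑ j, w j * u j ^ 2) / (∑ j, w j * lam j * u j ^ 2) * L := by
  obtain ⟨i, hi⟩ := Function.ne_iff.1 hu
  have hi : u i ≠ 0 := hi
  have hpos : 0 < ∑ j, w j * lam j * u j ^ 2 :=
    Finset.sum_pos' (fun j _ => by have := hw j; have := hlam j; positivity)
      ⟨i, Finset.mem_univ i, by have := hw i; have := hlam i; positivity⟩
  rw [div_mul_eq_mul_div, le_div_iff₀ hpos, one_mul, Finset.sum_mul]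
  refine Finset.sum_le_sum fun j _ => ?_
  have := mul_le_mul_of_nonneg_left (hL j) (mul_nonneg (hw j).le (sq_nonneg (u j)))
  linarith

/-- A step-size that is the inverse of a weighted mean of the spectrum is at most `1 / m`. -/
lemma weighted_step_mul_le_one {ι : Type*} [Fintype ι] {lam w u : ι → ℝ} {m : ℝ}
    (hw : ∀ i, 0 < w i) (hlam : ∀ i, 0 < lam i) (hm : ∀ i, m ≤ lam i) (hu : u ≠ 0) :
    (∑ j, w j * u j ^ 2) / (∑ j, w j * lam j * u j ^ 2) * m ≤ 1 := by
  obtain ⟨i, hi⟩ := Function.ne_iff.1 hu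
  have hi : u i ≠ 0 := hi
  have hpos : 0 < ∑ j, w j * lam j * u j ^ 2 :=
    Finset.sum_pos' (fun j _ => by have := hw j; have := hlam j; positivity)
      ⟨i, Finset.mem_univ i, by have := hw i; have := hlam i; positivity⟩
  rw [div_mul_eq_mul_div, div_le_iff₀ hpos, one_mul, Finset.sum_mul]
  refine Finset.sum_le_sum fun j _ => ?_
  have := mul_le_mul_of_nonneg_left (hm j) (mul_nonneg (hw j).le (sq_nonneg (u j)))
  linarith

/-- If the components of `u` with eigenvalue below `lam i` are dominated by the `i`-th one, then
the weighted step-size is at most `(1 + ρ) / lam i`. -/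
lemma weighted_step_mul_le {ι : Type*} [Fintype ι] {lam w u : ι → ℝ} {ρ : ℝ} (hρ : 0 ≤ ρ)
    (hw : ∀ i, 0 < w i) (hlam : ∀ i, 0 < lam i) (hu : u ≠ 0) (i : ι)
    (hdom : ∑ j with lam j < lam i, w j * u j ^ 2 ≤ ρ * (w i * u i ^ 2)) :
    (∑ j, w j * u j ^ 2) / (∑ j, w j * lam j * u j ^ 2) * lam i ≤ 1 + ρ := by
  obtain ⟨l, hl⟩ := Function.ne_iff.1 hu
  have hl : u l ≠ 0 := hl
  have hpos : 0 < ∑ j, w j * lam j * u j ^ 2 :=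
    Finset.sum_pos' (fun j _ => by have := hw j; have := hlam j; positivity)
      ⟨l, Finset.mem_univ l, by have := hw l; have := hlam l; positivity⟩
  have hnn : ∀ j, 0 ≤ w j * u j ^ 2 := fun j => mul_nonneg (hw j).le (sq_nonneg _)
  rw [div_mul_eq_mul_div, div_le_iff₀ hpos]
  set S₁ := ∑ j with ¬ lam j < lam i, w j * u j ^ 2 with hS₁
  have hsplit : ∑ j, w j * u j ^ 2 = ∑ j with lam j < lam i, w j * u j ^ 2 + S₁ :=
    (Finset.sum_filter_add_sum_filter_not _ _ _).symm
  have hi : w i * u i ^ 2 ≤ S₁ :=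
    Finset.single_le_sum (f := fun j => w j * u j ^ 2) (fun j _ => hnn j) (by simp)
  have hden : lam i * S₁ ≤ ∑ j, w j * lam j * u j ^ 2 := by
    rw [hS₁, Finset.mul_sum]
    refine (Finset.sum_le_sum fun j hj => ?_).trans
      (Finset.sum_le_univ_sum_of_nonneg fun j => ?_)
    · have := mul_le_mul_of_nonneg_right (not_lt.1 (Finset.mem_filter.1 hj).2) (hnn j)
      linarith
    · have := mul_nonneg (hlam j).le (hnn j)
      linarith
  have hsum : ∑ j, w j * u j ^ 2 ≤ (1 + ρ) * S₁ := by
    have := mul_le_mul_of_nonneg_left hi hρ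
    linarith
  calc (∑ j, w j * u j ^ 2) * lam i ≤ (1 + ρ) * S₁ * lam i :=
        mul_le_mul_of_nonneg_right hsum (hlam i).le
    _ = (1 + ρ) * (lam i * S₁) := by ring
    _ ≤ _ := mul_le_mul_of_nonneg_left hden (by linarith)

/-- A sequence whose every step contracts by `ρ` or lands below `B * ρ ^ k` decays like `ρ ^ k`. -/
lemma exists_le_mul_pow_of_step {a : ℕ → ℝ} {ρ B : ℝ} (hρ : 0 < ρ)
    (h : ∀ k, a (k + 2) ≤ ρ * a (k + 1) ∨ a (k + 2) ≤ B * ρ ^ (k + 2)) :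
    ∃ C, 0 ≤ C ∧ ∀ k, a k ≤ C * ρ ^ k := by
  -- The hypothesis constrains only indices from 2 on, so the constant absorbs `a 0` and `a 1`
  -- separately.
  refine ⟨max (max 0 (a 0)) (max (a 1 / ρ) B), by simp, ?_⟩
  set C := max (max 0 (a 0)) (max (a 1 / ρ) B)
  have h1 : ∀ k, a (k + 1) ≤ C * ρ ^ (k + 1) := by
    intro k
    induction k with
    | zero =>
      have : a 1 / ρ ≤ C := (le_max_left _ _).trans (le_max_right _ _)
      simpa using (div_le_iff₀ hρ).1 this
    | succ k ih =>
      rcases h k with h | h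
      · calc a (k + 2) ≤ ρ * (C * ρ ^ (k + 1)) := h.trans (mul_le_mul_of_nonneg_left ih hρ.le)
          _ = C * ρ ^ (k + 2) := by ring
      · refine h.trans (mul_le_mul_of_nonneg_right ?_ (by positivity))
        exact (le_max_right _ _).trans (le_max_right _ _)
  intro k
  cases k with
  | zero => simpa only [pow_zero, mul_one] using (le_max_right 0 (a 0)).trans (le_max_left _ (max (a 1 / ρ) B))
  | succ k => exact h1 k

/-- The diagonal gradient iteration with delayed weighted step-sizes decays like
`(1 - m / L) ^ k`, componentwise. -/
lemma exists_abs_le_mul_pow_of_weighted_step {ι : Type*} [Fintype ι] {lam w : ι → ℝ} {m L : ℝ}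
    (hm0 : 0 < m) (hm : ∀ i, m ≤ lam i) (hL : ∀ i, lam i ≤ L) (hw : ∀ i, 0 < w i)
    {u : ℕ → ι → ℝ} {α : ℕ → ℝ} (hu : ∀ k i, u (k + 1) i = (1 - α k * lam i) * u k i)
    (hα : ∀ k, u k ≠ 0 →
      α (k + 1) = (∑ j, w j * u k j ^ 2) / (∑ j, w j * lam j * u k j ^ 2))
    (i : ι) : ∃ C, 0 ≤ C ∧ ∀ k, 2 ≤ k → |u k i| ≤ C * (1 - m / L) ^ k := by
  have hlam : ∀ i, 0 < lam i := fun i => hm0.trans_le (hm i)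
  have hL0 : 0 < L := (hlam i).trans_le (hL i)
  have hmL : m ≤ L := (hm i).trans (hL i)
  have hρ0 : 0 ≤ 1 - m / L := sub_nonneg.2 ((div_le_one hL0).2 hmL)
  have hzero : ∀ k, u k = 0 → u (k + 1) = 0 := fun k hk => by
    ext j; simp [hu, hk]
  have hαL : ∀ k, u k ≠ 0 → 1 / L ≤ α (k + 1) := fun k hk => by
    rw [div_le_iff₀ hL0, hα k hk]; exact one_le_mul_weighted_step hw hlam hL hk
  have hαm : ∀ k, u k ≠ 0 → α (k + 1) ≤ 1 / m := fun k hk => by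
    rw [le_div_iff₀ hm0, hα k hk]; exact weighted_step_mul_le_one hw hlam hm hk
  -- Only the lower bound `-ρ ≤ 1 - α λ` can fail.
  have hup : ∀ k i, u k ≠ 0 → 1 - α (k + 1) * lam i ≤ 1 - m / L := fun k i hk => by
    have h1 : m / L ≤ lam i * (1 / L) := by
      rw [mul_one_div]; exact div_le_div_of_nonneg_right (hm i) hL0.le
    have := mul_le_mul_of_nonneg_left (hαL k hk) (hlam i).le
    linarith
  -- If `ρ = 0`, all eigenvalues coincide and `α 1 = 1/m` annihilates the error; `α 0` is arbitrary,
  -- hence `2 ≤ k`.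
  rcases hρ0.eq_or_lt with hρ | hρ
  · refine ⟨0, le_rfl, fun k hk => ?_⟩
    have hmL' : m = L := by
      have : m / L = 1 := by linarith
      rwa [div_eq_one_iff_eq hL0.ne'] at this
    have h2 : u 2 = 0 := by
      by_cases h0 : u 0 = 0
      · exact hzero _ (hzero _ h0)
      · ext j
        have hj : lam j = m := le_antisymm ((hL j).trans hmL'.ge) (hm j)
        have h1 : α 1 = 1 / m := le_antisymm (hαm 0 h0) (hmL' ▸ hαL 0 h0)
        rw [hu 1 j, hj, h1]
        simp [hm0.ne']
    have : u k = 0 := by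
      induction k, hk using Nat.le_induction with
      | base => exact h2
      | succ k _ ih => exact hzero k ih
    simp [this]
  · set ρ := 1 - m / L
    suffices H : ∀ i, ∃ C, 0 ≤ C ∧ ∀ k, |u k i| ≤ C * ρ ^ k by
      obtain ⟨C, hC, h⟩ := H i
      exact ⟨C, hC, fun k _ => h k⟩
    clear i
    intro i
    induction i using (Finite.wellFounded_of_trans_of_irrefl
      (fun a b : ι => lam a < lam b)).induction with
    | _ i ih => ?_
    choose! C hC0 hC using ih
    set D := ∑ j with lam j < lam i, w j * C j ^ 2
    have hD : 0 ≤ D := Finset.sum_nonneg fun j _ => mul_nonneg (hw j).le (sq_nonneg _)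
    -- Uniform growth factor; the term `|α 0|` covers the free initial step.
    set M := 1 + (1 / m + |α 0|) * lam i
    have hM : 0 ≤ M := by have := hlam i; positivity
    have hstep : ∀ k, |u (k + 1) i| ≤ M * |u k i| := by
      intro k
      by_cases hk : u k = 0
      · simp [hk, hzero k hk]
      rw [hu, abs_mul]
      refine mul_le_mul_of_nonneg_right ?_ (abs_nonneg _)
      have hαk : |α k| ≤ 1 / m + |α 0| := by
        cases k with
        | zero => have : 0 < 1 / m := by positivity
                  linarith
        | succ k =>
          have hk' : u k ≠ 0 := fun h => hk (hzero k h)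
          have h1 : 0 < 1 / L := by positivity
          rw [abs_of_nonneg (h1.le.trans (hαL k hk'))]
          linarith [hαm k hk', abs_nonneg (α 0)]
      calc |1 - α k * lam i| ≤ |1| + |α k * lam i| := abs_sub _ _
        _ = 1 + |α k| * lam i := by rw [abs_one, abs_mul, abs_of_pos (hlam i)]
        _ ≤ M := by have := mul_le_mul_of_nonneg_right hαk (hlam i).le; linarith
    -- Chosen so that `|u k i| > K * ρ ^ k` gives exactly the domination hypothesis of
    -- `weighted_step_mul_le`.
    set K := √(D / (ρ * w i))
    refine exists_le_mul_pow_of_step (B := M ^ 2 * K / ρ ^ 2) hρ fun k => ?_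
    by_cases hk : u k = 0
    · left; simp [hzero _ hk, hzero _ (hzero _ hk)]
    -- The test is at `k` because `u k` determines `α (k+1)`, which acts from `k+1` to `k+2`.
    by_cases hsmall : |u k i| ≤ K * ρ ^ k
    · right
      calc |u (k + 2) i| ≤ M * (M * |u k i|) :=
            (hstep (k + 1)).trans (mul_le_mul_of_nonneg_left (hstep k) hM)
        _ ≤ M * (M * (K * ρ ^ k)) := by gcongr
        _ = M ^ 2 * K / ρ ^ 2 * ρ ^ (k + 2) := by field_simp; ring
    · left
      rw [hu (k + 1) i, abs_mul]
      refine mul_le_mul_of_nonneg_right (abs_le.2 ⟨?_, hup k i hk⟩) (abs_nonneg _)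
      have hdom : ∑ j with lam j < lam i, w j * u k j ^ 2 ≤ ρ * (w i * u k i ^ 2) := by
        have hwi := hw i
        have h1 : ∑ j with lam j < lam i, w j * u k j ^ 2 ≤ D * ρ ^ (2 * k) := by
          rw [Finset.sum_mul]
          refine Finset.sum_le_sum fun j hj => ?_
          have h := hC j (Finset.mem_filter.1 hj).2 k
          have h2 : u k j ^ 2 ≤ (C j * ρ ^ k) ^ 2 := by
            rw [← sq_abs]; exact pow_le_pow_left₀ (abs_nonneg _) h 2
          calc w j * u k j ^ 2 ≤ w j * (C j * ρ ^ k) ^ 2 :=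
                mul_le_mul_of_nonneg_left h2 (hw j).le
            _ = _ := by ring
        have h2 : (K * ρ ^ k) ^ 2 ≤ u k i ^ 2 := by
          rw [← sq_abs (u k i)]
          exact pow_le_pow_left₀ (by positivity) (not_le.1 hsmall).le 2
        have h3 : K ^ 2 = D / (ρ * w i) := Real.sq_sqrt (by positivity)
        calc _ ≤ D * ρ ^ (2 * k) := h1
          _ = ρ * w i * (K * ρ ^ k) ^ 2 := by rw [mul_pow, h3]; field_simp; ring
          _ ≤ ρ * w i * u k i ^ 2 := mul_le_mul_of_nonneg_left h2 (by positivity)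
          _ = _ := by ring
      have := weighted_step_mul_le hρ.le hw hlam hk i hdom
      rw [← hα k hk] at this
      linarith

/-! ### Quadratic objectives, their step-sizes and eigencomponents. -/

section QuadraticObjective

variable {n : ℕ} {H : Matrix (Fin n) (Fin n) ℝ}

lemma Matrix.IsHermitian.inner_toEuclideanCLM_left (hH : H.IsHermitian)
    (x y : EuclideanSpace ℝ (Fin n)) :
    inner ℝ (toEuclideanCLM (𝕜 := ℝ) H x) y = inner ℝ x (toEuclideanCLM (𝕜 := ℝ) H y) :=
  isSymmetric_toEuclideanLin_iff.2 hH x y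

lemma Matrix.PosDef.inner_toEuclideanCLM_pos (hH : H.PosDef)
    {x : EuclideanSpace ℝ (Fin n)} (hx : x ≠ 0) :
    0 < inner ℝ x (toEuclideanCLM (𝕜 := ℝ) H x) := by
  have h := hH.dotProduct_mulVec_pos (x := x.ofLp) (by simpa using hx)
  rw [EuclideanSpace.inner_eq_star_dotProduct, ofLp_toEuclideanCLM, dotProduct_comm]
  exact h

lemma quadraticObjective_eq_inner (b x : EuclideanSpace ℝ (Fin n)) :
    quadraticObjective H b x =
      1 / 2 * inner ℝ x (toEuclideanCLM (𝕜 := ℝ) H x) + inner ℝ b x := by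
  simp [quadraticObjective, EuclideanSpace.inner_eq_star_dotProduct, ofLp_toEuclideanCLM,
    dotProduct_comm]

/-- The exact Taylor expansion behind both the equality of the two steps and strict minimality. -/
lemma quadraticObjective_add (hH : H.IsHermitian) (b x s : EuclideanSpace ℝ (Fin n)) :
    quadraticObjective H b (x + s) = quadraticObjective H b x +
      inner ℝ (toEuclideanCLM (𝕜 := ℝ) H x + b) s +
      1 / 2 * inner ℝ s (toEuclideanCLM (𝕜 := ℝ) H s) := by
  simp only [quadraticObjective_eq_inner, map_add, inner_add_left, inner_add_right]
  rw [hH.inner_toEuclideanCLM_left, real_inner_comm _ s, hH.inner_toEuclideanCLM_left]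
  ring

lemma gradient_quadraticObjective (hH : H.IsHermitian) (b x : EuclideanSpace ℝ (Fin n)) :
    gradient (quadraticObjective H b) x = toEuclideanCLM (𝕜 := ℝ) H x + b := by
  refine HasGradientAt.gradient (hasGradientAt_iff_hasFDerivAt.2 ?_)
  have h1 := (((hasFDerivAt_id x).inner ℝ
    (toEuclideanCLM (𝕜 := ℝ) H).hasFDerivAt).const_mul (1 / 2 : ℝ)).add
      ((hasFDerivAt_const b x).inner ℝ (hasFDerivAt_id x))
  refine (h1.congr_fderiv ?_).congr_of_eventuallyEq
    (Eventually.of_forall fun y => quadraticObjective_eq_inner b y)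
  ext v
  simp only [one_div, id_eq, _root_.add_apply, _root_.smul_apply,
    ContinuousLinearMap.comp_apply, ContinuousLinearMap.prod_apply, fderivInnerCLM_apply,
    InnerProductSpace.toDual_apply_apply, inner_add_left, ContinuousLinearMap.id_apply,
    _root_.zero_apply, inner_zero_left, smul_eq_mul]
  rw [hH.inner_toEuclideanCLM_left, real_inner_comm _ v, hH.inner_toEuclideanCLM_left]
  ring

lemma toEuclideanCLM_quadraticMinimizer (hH : H.PosDef) (b : EuclideanSpace ℝ (Fin n)) :
    toEuclideanCLM (𝕜 := ℝ) H (quadraticMinimizer H b) = -b := by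
  have : IsUnit H.det := (isUnit_iff_isUnit_det H).1 hH.isUnit
  rw [quadraticMinimizer, toEuclideanCLM_toLp, mulVec_neg, mulVec_mulVec, mul_nonsing_inv _ this,
    one_mulVec]
  rfl

lemma gradient_quadraticObjective_eq_sub (hH : H.PosDef) (b x : EuclideanSpace ℝ (Fin n)) :
    gradient (quadraticObjective H b) x =
      toEuclideanCLM (𝕜 := ℝ) H (x - quadraticMinimizer H b) := by
  rw [gradient_quadraticObjective hH.isHermitian, map_sub, toEuclideanCLM_quadraticMinimizer hH,
    sub_neg_eq_add]

lemma quadraticObjective_minimizer_lt (hH : H.PosDef) (b : EuclideanSpace ℝ (Fin n))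
    {z : EuclideanSpace ℝ (Fin n)} (hz : z ≠ quadraticMinimizer H b) :
    quadraticObjective H b (quadraticMinimizer H b) < quadraticObjective H b z := by
  have h := quadraticObjective_add hH.isHermitian b (quadraticMinimizer H b)
    (z - quadraticMinimizer H b)
  rw [add_sub_cancel, toEuclideanCLM_quadraticMinimizer hH, neg_add_cancel, inner_zero_left,
    add_zero] at h
  have := hH.inner_toEuclideanCLM_pos (sub_ne_zero.2 hz)
  linarith

/-- On quadratics, the short KGD step after a gradient step is the short Barzilai-Borwein step. -/
lemma shortKGDStep_quadraticObjective (hH : H.IsHermitian) (b x : EuclideanSpace ℝ (Fin n))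
    (α : ℝ) :
    shortKGDStep (quadraticObjective H b) (x - α • gradient (quadraticObjective H b) x) x α =
      shortBBStep (quadraticObjective H b) (x - α • gradient (quadraticObjective H b) x) x := by
  have h := quadraticObjective_add hH b x (-(α • gradient (quadraticObjective H b) x))
  rw [← sub_eq_add_neg, ← gradient_quadraticObjective hH] at h
  rw [shortKGDStep, shortBBStep, real_inner_self_eq_norm_sq, h]
  -- The term `α‖g‖²` cancels the first-order decrease; twice the quadratic term, `α² gᵀHg = sᵀy`,
  -- remains.
  congr 1
  simp only [gradient_quadraticObjective hH b (x - _), sub_sub_cancel_left,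
    inner_neg_left, inner_neg_right, inner_smul_right, map_neg, map_sub]
  rw [real_inner_self_eq_norm_sq]
  have : toEuclideanCLM (𝕜 := ℝ) H x -
      toEuclideanCLM (𝕜 := ℝ) H (α • gradient (quadraticObjective H b) x) + b -
      gradient (quadraticObjective H b) x =
      - toEuclideanCLM (𝕜 := ℝ) H (α • gradient (quadraticObjective H b) x) := by
    rw [gradient_quadraticObjective hH]; abel
  rw [this, inner_neg_right]
  ring

/-- Here `s = -αg` and `y = -αHg`, so `α²` cancels; this needs `α ≠ 0`. -/
lemma shortBBStep_quadraticObjective (hH : H.IsHermitian) (b x : EuclideanSpace ℝ (Fin n))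
    {α : ℝ} (hα : α ≠ 0) :
    shortBBStep (quadraticObjective H b) (x - α • gradient (quadraticObjective H b) x) x =
      inner ℝ (gradient (quadraticObjective H b) x)
        (toEuclideanCLM (𝕜 := ℝ) H (gradient (quadraticObjective H b) x)) /
      inner ℝ (toEuclideanCLM (𝕜 := ℝ) H (gradient (quadraticObjective H b) x))
        (toEuclideanCLM (𝕜 := ℝ) H (gradient (quadraticObjective H b) x)) := by
  have : gradient (quadraticObjective H b) (x - α • gradient (quadraticObjective H b) x) -
      gradient (quadraticObjective H b) x =
      -(α • toEuclideanCLM (𝕜 := ℝ) H (gradient (quadraticObjective H b) x)) := by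
    rw [gradient_quadraticObjective hH b (x - _), map_sub, map_smul]
    simp only [gradient_quadraticObjective hH b x]
    abel
  rw [shortBBStep, this, sub_sub_cancel_left]
  simp only [inner_neg_neg, real_inner_smul_left, inner_smul_right, ← mul_assoc]
  rw [mul_div_mul_left _ _ (mul_ne_zero hα hα)]

lemma Matrix.IsHermitian.inner_eigenvectorBasis_toEuclideanCLM (hH : H.IsHermitian) (i : Fin n)
    (y : EuclideanSpace ℝ (Fin n)) :
    inner ℝ (hH.eigenvectorBasis i) (toEuclideanCLM (𝕜 := ℝ) H y) =
      hH.eigenvalues i * inner ℝ (hH.eigenvectorBasis i) y := by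
  have : toEuclideanCLM (𝕜 := ℝ) H (hH.eigenvectorBasis i) =
      hH.eigenvalues i • hH.eigenvectorBasis i := by
    ext1
    rw [ofLp_toEuclideanCLM, hH.mulVec_eigenvectorBasis]
    rfl
  rw [← hH.inner_toEuclideanCLM_left, this, real_inner_smul_left]

lemma OrthonormalBasis.norm_le_sum_abs_inner {ι E : Type*} [Fintype ι] [NormedAddCommGroup E]
    [InnerProductSpace ℝ E] (v : OrthonormalBasis ι ℝ E) (x : E) :
    ‖x‖ ≤ ∑ i, |inner ℝ (v i) x| := by
  conv_lhs => rw [← v.sum_repr' x]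
  refine (norm_sum_le _ _).trans_eq (Finset.sum_congr rfl fun i _ => ?_)
  rw [norm_smul, v.norm_eq_one, mul_one, Real.norm_eq_abs]

/-- The Barzilai-Borwein quotient in terms of the eigencomponents of the error. -/
lemma Matrix.IsHermitian.barzilaiBorwein_quotient_eq (hH : H.IsHermitian)
    (e : EuclideanSpace ℝ (Fin n)) :
    inner ℝ (toEuclideanCLM (𝕜 := ℝ) H e)
        (toEuclideanCLM (𝕜 := ℝ) H (toEuclideanCLM (𝕜 := ℝ) H e)) /
      inner ℝ (toEuclideanCLM (𝕜 := ℝ) H (toEuclideanCLM (𝕜 := ℝ) H e))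
        (toEuclideanCLM (𝕜 := ℝ) H (toEuclideanCLM (𝕜 := ℝ) H e)) =
    (∑ j, hH.eigenvalues j ^ 3 * inner ℝ (hH.eigenvectorBasis j) e ^ 2) /
      (∑ j, hH.eigenvalues j ^ 3 * hH.eigenvalues j *
        inner ℝ (hH.eigenvectorBasis j) e ^ 2) := by
  congr 1 <;>
  -- By Parseval, `He` contributes a factor `λ` and `H²e` a factor `λ²`: `λ³` above, `λ⁴` below.
  · rw [← hH.eigenvectorBasis.sum_inner_mul_inner]
    refine Finset.sum_congr rfl fun j _ => ?_
    rw [real_inner_comm]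
    simp only [hH.inner_eigenvectorBasis_toEuclideanCLM]
    ring

end QuadraticObjective

/-! ### Gradient iterations and the main theorem. -/

/-- Two gradient iterations whose step-size rules agree along gradient steps have the same
iterates. -/
lemma IsGradientIteration.eq_of_step_eq {n : ℕ} {f : EuclideanSpace ℝ (Fin n) → ℝ}
    {step step' : EuclideanSpace ℝ (Fin n) → EuclideanSpace ℝ (Fin n) → ℝ → ℝ}
    {x₀ : EuclideanSpace ℝ (Fin n)} {α₀ : ℝ} {x x' : ℕ → EuclideanSpace ℝ (Fin n)}
    {α α' : ℕ → ℝ} (h : IsGradientIteration f step x₀ α₀ x α)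
    (h' : IsGradientIteration f step' x₀ α₀ x' α')
    (hstep : ∀ y a, step (y - a • gradient f y) y a = step' (y - a • gradient f y) y a) (k : ℕ) :
    x k = x' k := by
  -- Step-sizes are compared only before termination, since afterwards they are unconstrained.
  suffices H : x k = x' k ∧ (gradient f (x k) ≠ 0 → α k = α' k) from H.1
  induction k with
  | zero => exact ⟨h.x_zero.trans h'.x_zero.symm, fun _ => h.α_zero.trans h'.α_zero.symm⟩
  | succ k ih =>
    obtain ⟨hx, hα⟩ := ih
    by_cases hg : gradient f (x k) = 0
    · have h1 : x (k + 1) = x k := by rw [h.x_succ, hg, smul_zero, sub_zero]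
      have h2 : x' (k + 1) = x' k := by rw [h'.x_succ, ← hx, hg, smul_zero, sub_zero]
      exact ⟨by rw [h1, h2, hx], fun hne => absurd hg (h1 ▸ hne)⟩
    · have hα := hα hg
      refine ⟨by rw [h.x_succ, h'.x_succ, ← hx, hα], fun _ => ?_⟩
      rw [h.α_succ k hg, h'.α_succ k (hx ▸ hg), h.x_succ, h'.x_succ, ← hx, ← hα, hstep]

/-- The eigencomponents of the error of the short Barzilai-Borwein iteration decay like
`(1 - m / L) ^ k` if the spectrum of the Hessian lies in `[m, L]`. -/
lemma IsGradientIteration.exists_abs_inner_le {n : ℕ} {H : Matrix (Fin n) (Fin n) ℝ}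
    (hH : H.PosDef) {b x₀ : EuclideanSpace ℝ (Fin n)} {α₀ : ℝ} (hα₀ : α₀ ≠ 0)
    {x : ℕ → EuclideanSpace ℝ (Fin n)} {α : ℕ → ℝ}
    (h : IsGradientIteration (quadraticObjective H b)
      (fun xnew xold _ => shortBBStep (quadraticObjective H b) xnew xold) x₀ α₀ x α)
    {m L : ℝ} (hm0 : 0 < m) (hm : ∀ i, m ≤ hH.isHermitian.eigenvalues i)
    (hL : ∀ i, hH.isHermitian.eigenvalues i ≤ L) (i : Fin n) :
    ∃ C, 0 ≤ C ∧ ∀ k, 2 ≤ k →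
      |inner ℝ (hH.isHermitian.eigenvectorBasis i) (x k - quadraticMinimizer H b)| ≤
        C * (1 - m / L) ^ k := by
  set v := hH.isHermitian.eigenvectorBasis
  set lam := hH.isHermitian.eigenvalues
  set u : ℕ → Fin n → ℝ := fun k i => inner ℝ (v i) (x k - quadraticMinimizer H b)
  have hlam : ∀ i, 0 < lam i := fun i => hm0.trans_le (hm i)
  have hw : ∀ i, 0 < lam i ^ 3 := fun i => pow_pos (hlam i) 3
  have hu : ∀ k i, u (k + 1) i = (1 - α k * lam i) * u k i := fun k i => by
    simp only [u, v, lam]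
    rw [h.x_succ, gradient_quadraticObjective_eq_sub hH, sub_right_comm, inner_sub_right,
      inner_smul_right, hH.isHermitian.inner_eigenvectorBasis_toEuclideanCLM]
    ring
  have hgrad : ∀ k, u k ≠ 0 → gradient (quadraticObjective H b) (x k) ≠ 0 := fun k hk hg => by
    refine hk (funext fun i => ?_)
    rw [gradient_quadraticObjective_eq_sub hH] at hg
    have := hH.isHermitian.inner_eigenvectorBasis_toEuclideanCLM i (x k - quadraticMinimizer H b)
    rw [hg, inner_zero_right] at this
    exact (mul_eq_zero.1 this.symm).resolve_left (hlam i).ne'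
  have hstep : ∀ k, u k ≠ 0 → α k ≠ 0 → α (k + 1) =
      (∑ j, lam j ^ 3 * u k j ^ 2) / (∑ j, lam j ^ 3 * lam j * u k j ^ 2) := fun k hk hαk => by
    rw [h.α_succ k (hgrad k hk), h.x_succ, shortBBStep_quadraticObjective hH.isHermitian b _ hαk,
      gradient_quadraticObjective_eq_sub hH, hH.isHermitian.barzilaiBorwein_quotient_eq]
  -- A nonzero step makes the next one a weighted quotient, which is at least `1/L` and so nonzero
  -- again.
  have hne : ∀ k, u k ≠ 0 → α k ≠ 0 := by
    intro k
    induction k with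
    | zero => exact fun _ => h.α_zero ▸ hα₀
    | succ k ih =>
      intro hk hα
      have hk' : u k ≠ 0 := fun h0 => hk (funext fun i => by simp [hu, h0])
      have := one_le_mul_weighted_step hw hlam hL hk'
      rw [← hstep k hk' (ih hk'), hα, zero_mul] at this
      exact absurd this (by norm_num)
  exact exists_abs_le_mul_pow_of_weighted_step hm0 hm hL hw hu
    (fun k hk => hstep k hk (hne k hk)) i

/-- In the rate bound, the restriction `2 ≤ k` matters only if `κ(H) = 1`, where the rate is `0` and
the bound says `x k = x*` for `k ≥ 2`; if `κ(H) > 1`, enlarging `C` gives the bound for all `k`. -/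
theorem theorem3p2 {n : ℕ} (H : Matrix (Fin n) (Fin n) ℝ) (hH : H.PosDef)
    (b x₀ : EuclideanSpace ℝ (Fin n)) (α₀ : ℝ) (hα₀ : 0 < α₀)
    (x x' : ℕ → EuclideanSpace ℝ (Fin n)) (α α' : ℕ → ℝ)
    (hKGD : IsGradientIteration (quadraticObjective H b)
      (shortKGDStep (quadraticObjective H b)) x₀ α₀ x α)
    (hBB : IsGradientIteration (quadraticObjective H b)
      (fun xnew xold _ => shortBBStep (quadraticObjective H b) xnew xold) x₀ α₀ x' α') :
    (∀ k, x k = x' k) ∧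
    (∀ z, z ≠ quadraticMinimizer H b →
      quadraticObjective H b (quadraticMinimizer H b) < quadraticObjective H b z) ∧
    Tendsto x atTop (𝓝 (quadraticMinimizer H b)) ∧
    ∃ C : ℝ, ∀ k, 2 ≤ k →
      ‖x k - quadraticMinimizer H b‖ ≤ C * (1 - 1 / conditionNumber hH.isHermitian) ^ k := by
  have heq := hKGD.eq_of_step_eq hBB
    (fun y a => shortKGDStep_quadraticObjective hH.isHermitian b y a)
  obtain rfl : x = x' := funext heq
  refine ⟨heq, fun z hz => quadraticObjective_minimizer_lt hH b hz, ?_⟩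
  -- For `n = 0` the extremal eigenvalues default to `0`, so `0 < m` would fail; the space is then a
  -- single point.
  rcases isEmpty_or_nonempty (Fin n) with hn | hn
  · have hx : ∀ y : EuclideanSpace ℝ (Fin n), y = quadraticMinimizer H b :=
      fun y => Subsingleton.elim _ _
    refine ⟨?_, 0, fun k _ => ?_⟩
    · rw [funext fun k => hx (x k)]
      exact tendsto_const_nhds
    · rw [hx (x k), sub_self, norm_zero, zero_mul]
  set m := ⨅ i, hH.isHermitian.eigenvalues i
  set L := ⨆ i, hH.isHermitian.eigenvalues i
  have hm : ∀ i, m ≤ hH.isHermitian.eigenvalues i :=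
    fun i => ciInf_le (Set.finite_range _).bddBelow i
  have hL : ∀ i, hH.isHermitian.eigenvalues i ≤ L :=
    fun i => le_ciSup (Set.finite_range _).bddAbove i
  have hm0 : 0 < m := by
    obtain ⟨i, hi⟩ := exists_eq_ciInf_of_finite (f := hH.isHermitian.eigenvalues)
    exact (hH.eigenvalues_pos i).trans_eq hi
  have hmL : m ≤ L := (hm hn.some).trans (hL hn.some)
  have hL0 : 0 < L := hm0.trans_le hmL
  have hκ : 1 - 1 / conditionNumber hH.isHermitian = 1 - m / L := by
    rw [conditionNumber, one_div_div]
  choose C hC0 hC using hBB.exists_abs_inner_le hH hα₀.ne' hm0 hm hL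
  have hbound : ∀ k, 2 ≤ k →
      ‖x k - quadraticMinimizer H b‖ ≤ (∑ i, C i) * (1 - m / L) ^ k := fun k hk => by
    refine (hH.isHermitian.eigenvectorBasis.norm_le_sum_abs_inner _).trans ?_
    rw [Finset.sum_mul]
    exact Finset.sum_le_sum fun i _ => hC i k hk
  refine ⟨?_, ∑ i, C i, fun k hk => hκ ▸ hbound k hk⟩
  have hρ0 : 0 ≤ 1 - m / L := sub_nonneg.2 ((div_le_one hL0).2 hmL)
  have hρ1 : 1 - m / L < 1 := sub_lt_self _ (div_pos hm0 hL0)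
  rw [tendsto_iff_norm_sub_tendsto_zero]
  refine squeeze_zero' (Eventually.of_forall fun k => norm_nonneg _)
    (eventually_atTop.2 ⟨2, hbound⟩) ?_
  simpa using (tendsto_pow_atTop_nhds_zero_of_lt_one hρ0 hρ1).const_mul (∑ i, C i)
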